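/- For a finite group $X$ let $d(X)$ denote the minimal number of generators of $X$. A finite $p$-group $G$ is called $d$-maximal if $d(H)<d(G)$ for every proper subgroup $H<G$. Let $G$ be a $d$-maximal finite $2$-group with $d(G)=3$. Then $G$ has nilpotency class at most $2$, and $|G|\le 2^5$. -/

import Mathlib

/-- A finite group `G` is `d`-maximal if `d(H) < d(G)` for every proper subgroup `H` of `G`,
where `d` is the minimal number of generators. -/
def IsDMaximal (G : Type*) [Group G] [Finite G] : Prop :=
  ∀ H : Subgroup G, H < ⊤ → Group.rank H < Group.rank G

open Subgroup

/-! Let F be generated by the squares; for a 2-group with d(G) = 3 it lies in the Frattini subgroup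
and has index 8. The claim is that F is central of exponent two. Then G/F being abelian gives class
at most 2, and F, proper and so 2-generated, has order at most 4, whence |G| ≤ 32.

The engine is `mul_self_eq_one_of_commuting_triple`: three independent commuting involutions span a
group of order at least 8 needing three generators, so they span everything. Applied to G/L with L <
F normal (`false_of_commuting_triple_mod`), it forbids such triples, since G/L of exponent two would
force F ≤ L.

Centrality goes by induction on |G|: factor out a central involution z of F. In G, squares and
commutators of elements of F then lie in {1, z}. Two forbidden-triple arguments remove z:
`commute_of_conj_eq` makes F central, then `mul_self_eq_one_of_central` gives it exponent two. -/

/-- The subgroup generated by all squares. -/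
def squareSubgroup (G : Type*) [Group G] : Subgroup G :=
  closure (Set.range fun g : G => g * g)

/-! ### Squares, exponent two and orders of generated subgroups -/

section Squares

variable {G : Type*} [Group G]

theorem mul_self_mem_squareSubgroup (g : G) : g * g ∈ squareSubgroup G :=
  subset_closure ⟨g, rfl⟩

theorem squareSubgroup_le {H : Subgroup G} (h : ∀ g : G, g * g ∈ H) : squareSubgroup G ≤ H := by
  rw [squareSubgroup, closure_le]
  rintro _ ⟨g, rfl⟩
  exact h g

theorem Subgroup.normal_of_mul_self_mem {H : Subgroup G} (h : ∀ g : G, g * g ∈ H) : H.Normal := by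
  refine ⟨fun n hn g => ?_⟩
  have : g * n * g⁻¹ = (g * n) * (g * n) * n⁻¹ * (g⁻¹ * g⁻¹) := by group
  rw [this]
  exact mul_mem (mul_mem (h _) (inv_mem hn)) (h _)

instance : (squareSubgroup G).Normal :=
  normal_of_mul_self_mem mul_self_mem_squareSubgroup

theorem map_squareSubgroup {Q : Type*} [Group Q] (φ : G →* Q) (hφ : Function.Surjective φ) :
    (squareSubgroup G).map φ = squareSubgroup Q := by
  rw [squareSubgroup, squareSubgroup, MonoidHom.map_closure]
  congr 1
  ext q
  constructor
  · rintro ⟨_, ⟨g, rfl⟩, rfl⟩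
    exact ⟨φ g, (map_mul φ g g).symm⟩
  · rintro ⟨q, rfl⟩
    obtain ⟨g, rfl⟩ := hφ q
    exact ⟨g * g, ⟨g, rfl⟩, map_mul φ g g⟩

theorem mul_comm_of_mul_self_eq_one {a b : G} (ha : a * a = 1) (hb : b * b = 1)
    (hab : (a * b) * (a * b) = 1) : a * b = b * a := by
  have h := eq_inv_of_mul_eq_one_left hab
  rwa [mul_inv_rev, ← eq_inv_of_mul_eq_one_left ha, ← eq_inv_of_mul_eq_one_left hb] at h

/-- Exponent two makes the group abelian, so a new generator adds at most one coset. Finiteness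
rides along because the `ncard` bounds need it. -/
theorem card_closure_le_two_pow (h : ∀ x : G, x * x = 1) (S : Finset G) :
    Nat.card (closure (S : Set G)) ≤ 2 ^ S.card ∧ Finite (closure (S : Set G)) := by
  classical
  have hc : ∀ x y : G, x * y = y * x := fun x y => mul_comm_of_mul_self_eq_one (h x) (h y) (h _)
  induction S using Finset.induction_on with
  | empty => simp; infer_instance
  | insert a S ha ih =>
    obtain ⟨ih, hfin⟩ := ih
    have hfin' : (closure (S : Set G) : Set G).Finite := hfin
    have hsub : (closure ((insert a S : Finset G) : Set G) : Set G) ⊆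
        (closure (S : Set G) : Set G) ∪ (a * ·) '' (closure (S : Set G) : Set G) := by
      intro x hx
      induction hx using closure_induction with
      | mem x hx =>
        rcases Finset.mem_insert.1 (Finset.mem_coe.1 hx) with rfl | hx
        · exact Or.inr ⟨1, one_mem _, mul_one _⟩
        · exact Or.inl (subset_closure hx)
      | one => exact Or.inl (one_mem _)
      | mul x y _ _ hx hy =>
        rcases hx with hx | ⟨x, hx, rfl⟩ <;> rcases hy with hy | ⟨y, hy, rfl⟩
        · exact Or.inl (mul_mem hx hy)
        · refine Or.inr ⟨x * y, mul_mem hx hy, ?_⟩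
          simp only [← mul_assoc, hc x a]
        · exact Or.inr ⟨x * y, mul_mem hx hy, by simp only [mul_assoc]⟩
        · refine Or.inl ?_
          have : a * x * (a * y) = x * y := by
            rw [hc a x, mul_assoc, ← mul_assoc a a, h, one_mul]
          simp only [this]
          exact mul_mem hx hy
      | inv x _ hx =>
        rwa [← eq_inv_of_mul_eq_one_left (h x)]
    have hfin2 := hfin'.union (hfin'.image (a * ·))
    refine ⟨?_, hfin2.subset hsub⟩
    rw [Finset.card_insert_of_notMem ha, pow_succ, mul_two]
    calc Nat.card (closure ((insert a S : Finset G) : Set G))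
        ≤ _ := Set.ncard_le_ncard hsub hfin2
      _ ≤ _ := Set.ncard_union_le _ _
      _ ≤ _ := Nat.add_le_add ih ((Set.ncard_image_le hfin').trans ih)

theorem card_le_two_pow_rank [Group.FG G] (h : ∀ x : G, x * x = 1) :
    Nat.card G ≤ 2 ^ Group.rank G := by
  obtain ⟨S, hS, hcl⟩ := Group.rank_spec G
  have := (card_closure_le_two_pow h S).1
  rwa [hcl, hS, Nat.card_congr Subgroup.topEquiv.toEquiv] at this

theorem Subgroup.two_mul_card_le_of_lt [Finite G] {H K : Subgroup G} (h : H < K) :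
    2 * Nat.card H ≤ Nat.card K := by
  have hmul := relIndex_mul_relIndex ⊥ H K bot_le h.le
  rw [relIndex_bot_left, relIndex_bot_left] at hmul
  rw [← hmul, mul_comm]
  refine Nat.mul_le_mul_left _ ?_
  have h1 : H.relIndex K ≠ 1 := fun h1 => h.not_ge (relIndex_eq_one.1 h1)
  have h0 : H.relIndex K ≠ 0 := index_ne_zero_of_finite
  omega

theorem closure_lt_closure_insert {S : Set G} {a : G} (h : a ∉ closure S) :
    closure S < closure (insert a S) :=
  lt_of_le_of_ne (closure_mono (Set.subset_insert _ _))
    fun he => h (he ▸ subset_closure (Set.mem_insert _ _))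

theorem eight_le_card_closure [Finite G] {a b c : G} (ha : a ≠ 1) (hb : b ∉ closure {a})
    (hc : c ∉ closure {b, a}) : 8 ≤ Nat.card (closure {c, b, a}) := by
  have h1 : (⊥ : Subgroup G) < closure {a} := by
    rw [bot_lt_iff_ne_bot, Ne, closure_eq_bot_iff]
    simpa using ha
  have := two_mul_card_le_of_lt h1
  have := two_mul_card_le_of_lt (closure_lt_closure_insert hb)
  have := two_mul_card_le_of_lt (closure_lt_closure_insert hc)
  rw [card_bot] at *
  omega

theorem mul_self_eq_one_of_mem_closure {S : Set G} (hS : ∀ x ∈ S, x * x = 1)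
    (hc : ∀ x ∈ S, ∀ y ∈ S, x * y = y * x) {x : G} (hx : x ∈ closure S) : x * x = 1 := by
  have hcomm := isMulCommutative_closure hc
  induction hx using closure_induction with
  | mem x hx => exact hS x hx
  | one => exact one_mul 1
  | mul x y hx hy ihx ihy =>
    have : x * y = y * x := setLike_mul_comm hx hy
    calc x * y * (x * y) = x * (y * x) * y := by group
      _ = (x * x) * (y * y) := by rw [← this]; group
      _ = 1 := by rw [ihx, ihy, one_mul]
  | inv x _ ih => rw [← mul_inv_rev, ih, inv_one]

/-- Three independent commuting involutions force the whole group to have exponent two, if all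
proper subgroups are generated by two elements. -/
theorem mul_self_eq_one_of_commuting_triple [Finite G]
    (hG : ∀ H : Subgroup G, H ≠ ⊤ → Group.rank H ≤ 2) {a b c : G}
    (ha : a * a = 1) (hb : b * b = 1) (hc : c * c = 1)
    (hab : a * b = b * a) (hac : a * c = c * a) (hbc : b * c = c * b)
    (ha1 : a ≠ 1) (hba : b ∉ closure {a}) (hcba : c ∉ closure {b, a}) (x : G) : x * x = 1 := by
  have hsq : ∀ x ∈ closure {c, b, a}, x * x = 1 := by
    intro x hx
    refine mul_self_eq_one_of_mem_closure ?_ ?_ hx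
    · rintro x (rfl | rfl | rfl) <;> assumption
    · rintro x (rfl | rfl | rfl) y (rfl | rfl | rfl) <;> first | rfl | assumption | (symm; assumption)
  by_contra hx
  have htop : closure {c, b, a} ≠ ⊤ := fun h => hx (hsq x (h ▸ mem_top x))
  have h1 : Nat.card (closure {c, b, a}) ≤ 2 ^ Group.rank (closure {c, b, a}) :=
    card_le_two_pow_rank fun y => Subtype.ext (hsq y y.2)
  have h2 := Nat.pow_le_pow_right (n := 2) (by norm_num) (hG _ htop)
  have h3 := eight_le_card_closure ha1 hba hcba
  omega

theorem Subgroup.index_le_two {D : Subgroup G} (h : ∀ x y : G, x ∉ D → y ∉ D → x * y ∈ D) :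
    D.index ≤ 2 := by
  by_cases hD : D = ⊤
  · simp [hD]
  · obtain ⟨a, ha⟩ : ∃ a, a ∉ D := by
      by_contra! hh
      exact hD (eq_top_iff.2 fun x _ => hh x)
    refine (index_eq_two_iff_exists_notMem_and.2 ⟨a, ha, fun b => ?_⟩).le
    by_cases hb : b ∈ D
    · exact Or.inr hb
    · exact Or.inl (h b a hb ha)

theorem exists_closure_pair_eq_of_rank_le [Group.FG G] (h : Group.rank G ≤ 2) :
    ∃ a b : G, closure {a, b} = ⊤ := by
  obtain ⟨S, hS, hcl⟩ := Group.rank_spec G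
  have : S.card ≤ 2 := hS ▸ h
  interval_cases hk : S.card
  · rw [Finset.card_eq_zero] at hk
    subst hk
    refine ⟨1, 1, ?_⟩
    rw [eq_top_iff, ← hcl]
    exact closure_mono (by simp)
  · obtain ⟨a, rfl⟩ := Finset.card_eq_one.1 hk
    exact ⟨a, a, by simpa using hcl⟩
  · classical
    obtain ⟨a, b, -, rfl⟩ := Finset.card_eq_two.1 hk
    exact ⟨a, b, by simpa using hcl⟩

end Squares

/-! ### The inductive hypothesis and its quotients -/

/-- A finite group whose proper subgroups are generated by two elements while the largest
elementary abelian `2`-quotient has order eight. -/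
structure MinimalThreeGenerated (G : Type*) [Group G] [Finite G] : Prop where
  rank_le : ∀ H : Subgroup G, H ≠ ⊤ → Group.rank H ≤ 2
  index_eq : (squareSubgroup G).index = 8

theorem rank_le_two_of_surjective {G Q : Type*} [Group G] [Finite G] [Group Q] [Finite Q]
    (hG : ∀ H : Subgroup G, H ≠ ⊤ → Group.rank H ≤ 2)
    (φ : G →* Q) (hφ : Function.Surjective φ) (H : Subgroup Q) (hH : H ≠ ⊤) :
    Group.rank H ≤ 2 := by
  have hK : H.comap φ ≠ ⊤ := by
    intro h
    apply hH
    rw [← map_comap_eq_self_of_surjective hφ H, h, ← MonoidHom.range_eq_map,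
      MonoidHom.range_eq_top.2 hφ]
  exact (Group.rank_le_of_surjective (φ.subgroupComap H)
    (φ.subgroupComap_surjective_of_surjective H hφ)).trans (hG _ hK)

namespace MinimalThreeGenerated

variable {G : Type*} [Group G] [Finite G]

theorem of_surjective {Q : Type*} [Group Q] [Finite Q] (hG : MinimalThreeGenerated G)
    (φ : G →* Q) (hφ : Function.Surjective φ) (hker : φ.ker ≤ squareSubgroup G) :
    MinimalThreeGenerated Q where
  rank_le := rank_le_two_of_surjective hG.rank_le φ hφ
  index_eq := by rw [← map_squareSubgroup φ hφ, index_map_eq _ hφ hker, hG.index_eq]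

theorem squareSubgroup_ne_top (hG : MinimalThreeGenerated G) : squareSubgroup G ≠ ⊤ := by
  intro h
  have := hG.index_eq
  simp [h] at this

/-- A subgroup of index at most two contains two elements independent modulo squares. -/
theorem exists_independent_pair (hG : MinimalThreeGenerated G) {C : Subgroup G}
    (hF : squareSubgroup G ≤ C) (hC : C.index ≤ 2) :
    ∃ b ∈ C, ∃ c ∈ C, b ∉ squareSubgroup G ∧ c ∉ squareSubgroup G ⊔ zpowers b := by
  obtain ⟨b, hb, hbF⟩ : ∃ b ∈ C, b ∉ squareSubgroup G := by
    by_contra! h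
    have := hG.index_eq
    rw [le_antisymm hF h] at this
    omega
  refine ⟨b, hb, ?_⟩
  by_contra! h
  have hle : C ≤ squareSubgroup G ⊔ zpowers b := fun c hc => h c hc hbF
  set π := QuotientGroup.mk' (squareSubgroup G)
  have hπ : Function.Surjective π := QuotientGroup.mk'_surjective _
  have h1 : C.map π ≤ zpowers (π b) := by
    refine (map_mono hle).trans ?_
    rw [Subgroup.map_sup, MonoidHom.map_zpowers, QuotientGroup.map_mk'_self, bot_sup_eq]
  have h2 : Nat.card (zpowers (π b)) ≤ 2 := by
    rw [Nat.card_zpowers]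
    refine orderOf_le_of_pow_eq_one (by norm_num) ?_
    rw [← map_pow, pow_two]
    exact (QuotientGroup.eq_one_iff _).2 (mul_self_mem_squareSubgroup b)
  have h3 : (C.map π).index = C.index :=
    index_map_eq _ hπ (by rwa [QuotientGroup.ker_mk'])
  have h4 := (C.map π).card_mul_index
  have h5 : Nat.card (G ⧸ squareSubgroup G) = 8 := hG.index_eq
  have h6 := card_le_of_le h1
  rw [h3, h5] at h4
  -- The image of C would have order and index at most 2 in a group of order 8.
  have := Nat.mul_le_mul (h6.trans h2) hC
  omega

/-- The images of f, b, c in G/L commute because their pairwise products square to 1. Independence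
is certified by subgroups: F contains f but not b, and A contains f and b but not c. -/
theorem false_of_commuting_triple_mod (hG : MinimalThreeGenerated G) {L A : Subgroup G}
    (hn : L.Normal) (hLF : L ≤ squareSubgroup G) (hLA : L ≤ A) {f b c : G}
    (hf : f ∈ squareSubgroup G) (hfL : f ∉ L) (hb : b ∉ squareSubgroup G)
    (hfA : f ∈ A) (hbA : b ∈ A) (hc : c ∉ A) (hff : f * f ∈ L) (hbb : b * b ∈ L)
    (hcc : c * c ∈ L) (hfb : f * b * (f * b) ∈ L) (hfc : f * c * (f * c) ∈ L)
    (hbc : b * c * (b * c) ∈ L) : False := by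
  have key : ∀ {x : G}, x * x ∈ L → (x : G ⧸ L) * x = 1 := fun h =>
    (QuotientGroup.eq_one_iff _).2 h
  set π := QuotientGroup.mk' L
  have hmem : ∀ {B : Subgroup G}, L ≤ B → ∀ {x : G}, (x : G ⧸ L) ∈ B.map π → x ∈ B := by
    intro B hB x hx
    have : x ∈ (B.map π).comap π := hx
    rwa [comap_map_eq_self (by rwa [QuotientGroup.ker_mk'])] at this
  have hrank := rank_le_two_of_surjective hG.rank_le π (QuotientGroup.mk'_surjective L)
  have hexp := mul_self_eq_one_of_commuting_triple hrank (a := (f : G ⧸ L)) (b := b) (c := c)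
    (key hff) (key hbb) (key hcc)
    (mul_comm_of_mul_self_eq_one (key hff) (key hbb) (key hfb))
    (mul_comm_of_mul_self_eq_one (key hff) (key hcc) (key hfc))
    (mul_comm_of_mul_self_eq_one (key hbb) (key hcc) (key hbc))
    (fun h => hfL ((QuotientGroup.eq_one_iff _).1 h))
    (fun h => hb (hmem hLF ((closure_le _).2 (by
      rintro _ rfl
      exact ⟨f, hf, rfl⟩) h)))
    (fun h => hc (hmem hLA ((closure_le _).2 (by
      rintro _ (rfl | rfl)
      exacts [⟨b, hbA, rfl⟩, ⟨f, hfA, rfl⟩]) h)))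
  exact hfL (squareSubgroup_le (fun g => (QuotientGroup.eq_one_iff (g * g)).1
    ((QuotientGroup.mk_mul L g g).trans (hexp g))) hf)

/-! ### Removing the central involution -/

section Central

variable {z : G}

/-- If conjugation moves squares by at most a central involution, then squares are central. -/
theorem commute_of_conj_eq (hG : MinimalThreeGenerated G)
    (hzc : ∀ g, g * z = z * g) (hz2 : z * z = 1) (hzF : z ∈ squareSubgroup G)
    (hconj : ∀ f ∈ squareSubgroup G, ∀ g, g * f = f * g ∨ g * f = f * z * g)
    (hsq : ∀ f ∈ squareSubgroup G, f * f = 1 ∨ f * f = z) :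
    ∀ f ∈ squareSubgroup G, ∀ g, g * f = f * g := by
  have hmul : ∀ f ∈ squareSubgroup G, ∀ x y, x * f = f * z * x → y * f = f * z * y →
      x * y * f = f * (x * y) := by
    intro f _ x y hx hy
    calc x * y * f = x * (y * f) := by group
      _ = (x * f) * z * y := by rw [hy]; group
      _ = f * (z * x) * z * y := by rw [hx]; group
      _ = f * x * (z * z) * y := by rw [← hzc]; group
      _ = f * (x * y) := by rw [hz2]; group
  have hidx : ∀ f ∈ squareSubgroup G, (centralizer {f}).index ≤ 2 := by
    intro f hf
    refine index_le_two fun x y hx hy => ?_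
    rw [mem_centralizer_singleton_iff] at *
    exact hmul f hf x y ((hconj f hf x).resolve_left hx) ((hconj f hf y).resolve_left hy)
  -- Commuting x past f twice produces z twice or not at all, so squares centralize F, and F is
  -- abelian.
  have hsqc : ∀ f ∈ squareSubgroup G, ∀ x, x * x * f = f * (x * x) := by
    intro f hf x
    rcases hconj f hf x with h | h
    · rw [mul_assoc, h, ← mul_assoc, h, mul_assoc]
    · exact hmul f hf x x h h
  set C := centralizer (squareSubgroup G : Set G) with hC
  have hmemC : ∀ {g}, g ∈ C ↔ ∀ f ∈ squareSubgroup G, f * g = g * f := by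
    intro g; exact mem_centralizer_iff
  have hFC : squareSubgroup G ≤ C := squareSubgroup_le fun x => hmemC.2 fun f hf =>
    (hsqc f hf x).symm
  by_contra hcon
  obtain ⟨y₀, hy₀⟩ : ∃ y, y ∉ C := by
    by_contra! h
    exact hcon fun f hf g => (hmemC.1 (h g) f hf).symm
  have hyy : ∀ y k, k ∈ C → y * (y * k * (y * k)) = (y * k * (y * k)) * y := by
    intro y k hk
    have h := hmemC.1 hk _ (mul_self_mem_squareSubgroup (y * k))
    have h2 : y * (y * k * (y * k)) * k = (y * k * (y * k)) * y * k := by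
      rw [mul_assoc y, h]; group
    exact mul_right_cancel h2
  -- Otherwise f, k, y form a forbidden triple modulo the centralizer of y in F, where f in F does
  -- not commute with y.
  have hP : ∀ k ∈ C, k ∉ squareSubgroup G → ∀ y, y ∉ C → y * (k * k) ≠ k * k * y := by
    intro k hk hkF y hy hcomm
    obtain ⟨f, hf, hfy⟩ : ∃ f ∈ squareSubgroup G, f * y ≠ y * f := by
      by_contra! h
      exact hy (hmemC.2 h)
    have hmemL : ∀ {g}, g ∈ squareSubgroup G ⊓ centralizer {y} ↔
        g ∈ squareSubgroup G ∧ g * y = y * g := by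
      intro g
      rw [mem_inf, mem_centralizer_singleton_iff]
    have hzL : z ∈ squareSubgroup G ⊓ centralizer {y} := hmemL.2 ⟨hzF, (hzc y).symm⟩
    have hn : (squareSubgroup G ⊓ centralizer {y}).Normal := by
      refine ⟨fun l hl g => ?_⟩
      rcases hconj l (hmemL.1 hl).1 g with h | h
      · rwa [h, mul_inv_cancel_right]
      · rw [h, mul_inv_cancel_right]
        exact mul_mem hl hzL
    have hffL : f * f ∈ squareSubgroup G ⊓ centralizer {y} := by
      rcases hsq f hf with h | h <;> rw [h]
      · exact one_mem _
      · exact hzL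
    have hyL : y * y ∈ squareSubgroup G ⊓ centralizer {y} :=
      hmemL.2 ⟨mul_self_mem_squareSubgroup y, mul_assoc y y y⟩
    have hkL : k * k ∈ squareSubgroup G ⊓ centralizer {y} :=
      hmemL.2 ⟨mul_self_mem_squareSubgroup k, hcomm.symm⟩
    have hykL : y * k * (y * k) ∈ squareSubgroup G ⊓ centralizer {y} :=
      hmemL.2 ⟨mul_self_mem_squareSubgroup _, (hyy y k hk).symm⟩
    refine hG.false_of_commuting_triple_mod hn inf_le_left (inf_le_left.trans hFC) hf
      (fun h => hfy (hmemL.1 h).2) hkF (hFC hf) hk hy hffL hkL hyL ?_ ?_ ?_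
    · have : f * k * (f * k) = f * f * (k * k) := by
        rw [mul_assoc, ← mul_assoc k, ← hmemC.1 hk f hf]; group
      rw [this]
      exact mul_mem hffL hkL
    · have h := (hconj f hf y).resolve_left (Ne.symm hfy)
      have : f * y * (f * y) = f * f * z * (y * y) := by
        rw [mul_assoc, ← mul_assoc y, h]; group
      rw [this]
      exact mul_mem (mul_mem hffL hzL) hyL
    · have : k * y * (k * y) = y⁻¹ * (y * k * (y * k)) * y⁻¹⁻¹ := by group
      rw [this]
      exact hn.conj_mem _ hykL _
  -- F is 2-generated, so C is cut out by two centralizers of index at most 2. As F has index 8, C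
  -- is strictly larger than F.
  have hidx4 : C.index ≤ 4 := by
    obtain ⟨a, b, hab⟩ := exists_closure_pair_eq_of_rank_le
      (hG.rank_le _ hG.squareSubgroup_ne_top)
    have hle : centralizer {(a : G)} ⊓ centralizer {(b : G)} ≤ C := by
      intro g hg
      rw [mem_inf, mem_centralizer_singleton_iff, mem_centralizer_singleton_iff] at hg
      have htop : (⊤ : Subgroup (squareSubgroup G)) ≤
          (centralizer {g}).comap (squareSubgroup G).subtype := by
        rw [← hab, closure_le]
        rintro x (rfl | rfl)
        · exact mem_centralizer_singleton_iff.2 hg.1.symm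
        · exact mem_centralizer_singleton_iff.2 hg.2.symm
      exact hmemC.2 fun f hf => mem_centralizer_singleton_iff.1 (htop (mem_top ⟨f, hf⟩))
    calc C.index ≤ _ := Nat.le_of_dvd (Nat.pos_of_ne_zero index_ne_zero_of_finite)
          (index_dvd_of_le hle)
      _ ≤ _ := index_inf_le
      _ ≤ 2 * 2 := Nat.mul_le_mul (hidx _ a.2) (hidx _ b.2)
  obtain ⟨k, hk, hkF⟩ : ∃ k ∈ C, k ∉ squareSubgroup G := by
    by_contra! h
    have := hG.index_eq
    rw [le_antisymm hFC h] at this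
    omega
  have hidx2 : C.index ≤ 2 := by
    have hle : centralizer {k * k} ≤ C := by
      intro y hy
      by_contra hyC
      exact hP k hk hkF y hyC (mem_centralizer_singleton_iff.1 hy)
    exact (Nat.le_of_dvd (Nat.pos_of_ne_zero index_ne_zero_of_finite)
      (index_dvd_of_le hle)).trans (hidx _ (mul_self_mem_squareSubgroup k))
  obtain ⟨k₁, hk₁, k₂, hk₂, hk₁F, hk₂F⟩ := hG.exists_independent_pair hFC hidx2
  have hk₂F' : k₂ ∉ squareSubgroup G := fun h => hk₂F (le_sup_left (α := Subgroup G) h)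
  have hk₁₂F : k₁ * k₂ ∉ squareSubgroup G := by
    intro h
    refine hk₂F ?_
    rw [← inv_mul_cancel_left k₁ k₂]
    exact mul_mem (inv_mem (le_sup_right (α := Subgroup G) (mem_zpowers k₁)))
      (le_sup_left (α := Subgroup G) h)
  -- The commutator with y₀ is multiplicative on k₁, k₂. By `hP` and `hE`, y₀ fails to commute with
  -- e k₁ and e k₂; the two factors z cancel in e (k₁ * k₂), contradicting `hP` for k₁ * k₂.
  set e : G → G := fun k => y₀ * k * y₀⁻¹ * k⁻¹ with he
  have hW : ∀ k ∈ C, y₀ * k * (y₀ * k) = e k * (k * k) * (y₀ * y₀) := by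
    intro k hk
    have h := hmemC.1 hk _ (mul_self_mem_squareSubgroup y₀)
    calc y₀ * k * (y₀ * k) = y₀ * k * y₀⁻¹ * (y₀ * y₀ * k) := by group
      _ = e k * (k * k) * (y₀ * y₀) := by rw [h, he]; group
  have heF : ∀ k ∈ C, e k ∈ squareSubgroup G := by
    intro k hk
    have : e k = y₀ * k * (y₀ * k) * (y₀ * y₀)⁻¹ * (k * k)⁻¹ := by rw [hW k hk]; group
    rw [this]
    exact mul_mem (mul_mem (mul_self_mem_squareSubgroup _)
      (inv_mem (mul_self_mem_squareSubgroup _))) (inv_mem (mul_self_mem_squareSubgroup _))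
  have hE : ∀ k ∈ C, y₀ * e k = e k * y₀ → y₀ * (k * k) = k * k * y₀ := by
    intro k hk h
    have h1 : Commute y₀ (e k * (k * k) * (y₀ * y₀)) := by
      rw [← hW k hk]
      exact hyy y₀ k hk
    have h2 : Commute y₀ (e k) := h
    have h3 : Commute y₀ (y₀ * y₀) := (Commute.refl y₀).mul_right (Commute.refl y₀)
    have h4 : k * k = (e k)⁻¹ * (e k * (k * k) * (y₀ * y₀)) * (y₀ * y₀)⁻¹ := by group
    have h5 : Commute y₀ (k * k) := by
      rw [h4]
      exact (h2.inv_right.mul_right h1).mul_right h3.inv_right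
    exact h5
  have hne : ∀ k ∈ C, k ∉ squareSubgroup G → y₀ * e k = e k * z * y₀ := fun k hk hkF =>
    (hconj _ (heF k hk) y₀).resolve_left fun h => hP k hk hkF y₀ hy₀ (hE k hk h)
  have hemul : e (k₁ * k₂) = e k₁ * e k₂ := by
    have h := hmemC.1 (inv_mem hk₁) _ (heF k₂ hk₂)
    calc e (k₁ * k₂) = y₀ * k₁ * y₀⁻¹ * (e k₂ * k₁⁻¹) := by simp only [he]; group
      _ = e k₁ * e k₂ := by rw [h]; simp only [he]; group
  refine hP _ (mul_mem hk₁ hk₂) hk₁₂F y₀ hy₀ (hE _ (mul_mem hk₁ hk₂) ?_)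
  rw [hemul]
  calc y₀ * (e k₁ * e k₂) = e k₁ * z * (y₀ * e k₂) := by rw [← mul_assoc, hne k₁ hk₁ hk₁F]; group
    _ = e k₁ * (z * e k₂) * z * y₀ := by rw [hne k₂ hk₂ hk₂F']; group
    _ = e k₁ * e k₂ * (z * z) * y₀ := by rw [← hzc]; group
    _ = e k₁ * e k₂ * y₀ := by rw [hz2]; group

/-- If squares are central and fourth powers lie in a group of order two, then squares are
involutions. -/
theorem mul_self_eq_one_of_central (hG : MinimalThreeGenerated G) (hz2 : z * z = 1)
    (hsq : ∀ f ∈ squareSubgroup G, f * f = 1 ∨ f * f = z)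
    (hcen : ∀ f ∈ squareSubgroup G, ∀ g, g * f = f * g) :
    ∀ f ∈ squareSubgroup G, f * f = 1 := by
  -- Since x² is central, squaring the conjugate c * x of x gives c² x² = x².
  have hcomm : ∀ x y : G, ∃ c ∈ squareSubgroup G, c * c = 1 ∧ y * x = c * x * y := by
    intro x y
    have hcF : y * x * y⁻¹ * x⁻¹ ∈ squareSubgroup G := by
      have : y * x * y⁻¹ * x⁻¹ = y * x * (y * x) * (x⁻¹ * (y⁻¹ * y⁻¹) * x⁻¹⁻¹) * (x⁻¹ * x⁻¹) := by
        group
      rw [this]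
      exact mul_mem (mul_mem (mul_self_mem_squareSubgroup _)
        (Subgroup.Normal.conj_mem inferInstance _ (mul_self_mem_squareSubgroup _) _))
        (mul_self_mem_squareSubgroup _)
    refine ⟨_, hcF, ?_, by group⟩
    set c := y * x * y⁻¹ * x⁻¹ with hc
    have h1 : c * x = y * x * y⁻¹ := by rw [hc]; group
    have h2 : c * x * (c * x) = x * x := by
      rw [h1]
      calc y * x * y⁻¹ * (y * x * y⁻¹) = y * (x * x) * y⁻¹ := by group
        _ = x * x := by rw [hcen _ (mul_self_mem_squareSubgroup x), mul_inv_cancel_right]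
    have h3 : c * x * (c * x) = c * c * (x * x) := by
      rw [mul_assoc, ← mul_assoc x, hcen c hcF x]; group
    rw [h3] at h2
    exact mul_eq_right.1 h2
  have hfour : ∀ x y : G, x * y * (x * y) * (x * y * (x * y)) =
      x * x * (x * x) * (y * y * (y * y)) := by
    intro x y
    obtain ⟨c, hcF, hcc, hyx⟩ := hcomm x y
    have h1 : x * y * (x * y) = c * (x * x * (y * y)) := by
      calc x * y * (x * y) = x * (y * x) * y := by group
        _ = (x * c) * x * y * y := by rw [hyx]; group
        _ = c * (x * x * (y * y)) := by rw [hcen c hcF]; group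
    rw [h1]
    calc c * (x * x * (y * y)) * (c * (x * x * (y * y)))
        = c * (x * x * (y * y) * c) * (x * x * (y * y)) := by group
      _ = c * c * (x * x) * (y * y * (x * x)) * (y * y) := by rw [hcen c hcF]; group
      _ = x * x * (x * x) * (y * y * (y * y)) := by
        rw [hcc, hcen _ (mul_self_mem_squareSubgroup x) (y * y)]; group
  -- The kernel of the fourth-power homomorphism, whose values lie in {1, z}.
  let K : Subgroup G :=
    { carrier := {x | x * x * (x * x) = 1}
      one_mem' := by simp
      mul_mem' := fun {x y} hx hy => by
        simp only [Set.mem_ofPred_eq] at *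
        rw [hfour, hx, hy, one_mul]
      inv_mem' := fun {x} hx => by
        simp only [Set.mem_ofPred_eq] at *
        rw [← mul_inv_rev, ← mul_inv_rev, hx, inv_one] }
  have hmemK : ∀ {x}, x ∈ K ↔ x * x * (x * x) = 1 := Iff.rfl
  have hK : K.index ≤ 2 := by
    refine index_le_two fun x y hx hy => ?_
    rw [hmemK] at *
    rw [hfour, (hsq _ (mul_self_mem_squareSubgroup x)).resolve_left hx,
      (hsq _ (mul_self_mem_squareSubgroup y)).resolve_left hy, hz2]
  have hFK : squareSubgroup G ≤ K := by
    intro f hf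
    rw [hmemK]
    rcases hsq f hf with h | h <;> rw [h]
    exacts [one_mul 1, hz2]
  obtain ⟨b, hb, c, hc, hbF, hcF⟩ := hG.exists_independent_pair hFK hK
  intro f hf
  -- An f in F with f² ≠ 1 would form a forbidden triple with b and c modulo the elements of F
  -- squaring to 1.
  by_contra hff
  let L : Subgroup G :=
    { carrier := {x | x ∈ squareSubgroup G ∧ x * x = 1}
      one_mem' := by simp
      mul_mem' := fun {x y} hx hy => by
        refine ⟨mul_mem hx.1 hy.1, ?_⟩
        rw [mul_assoc, ← mul_assoc y, hcen x hx.1 y, mul_assoc x, hy.2, mul_one, hx.2]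
      inv_mem' := fun {x} hx => ⟨inv_mem hx.1, by rw [← mul_inv_rev, hx.2, inv_one]⟩ }
  have hLF : L ≤ squareSubgroup G := fun x hx => hx.1
  have hn : L.Normal := ⟨fun l hl g => by rwa [hcen l hl.1, mul_inv_cancel_right]⟩
  have hKL : ∀ x ∈ K, x * x ∈ L := fun x hx => ⟨mul_self_mem_squareSubgroup x, hx⟩
  exact hG.false_of_commuting_triple_mod hn hLF (hLF.trans le_sup_left) hf (fun h => hff h.2) hbF
    (le_sup_left (α := Subgroup G) hf) (le_sup_right (α := Subgroup G) (mem_zpowers b)) hcF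
    (hKL f (hFK hf)) (hKL b hb) (hKL c hc) (hKL _ (mul_mem (hFK hf) hb))
    (hKL _ (mul_mem (hFK hf) hc)) (hKL _ (mul_mem hb hc))

end Central

/-! ### The induction and its consequences -/

theorem exists_central_involution (hp : IsPGroup 2 G) (h : squareSubgroup G ≠ ⊥) :
    ∃ z ∈ squareSubgroup G, z ≠ 1 ∧ z * z = 1 ∧ ∀ g, g * z = z * g := by
  have : Fact (Nat.Prime 2) := ⟨Nat.prime_two⟩
  have hp' : IsPGroup 2 (ConjAct G) := hp.of_equiv ConjAct.toConjAct
  have : Nontrivial (squareSubgroup G) := (nontrivial_iff_ne_bot _).2 h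
  have hdvd : 2 ∣ Nat.card (squareSubgroup G) := by
    obtain ⟨n, hn0, hn⟩ := (hp.to_subgroup (squareSubgroup G)).nontrivial_iff_card.1 inferInstance
    exact hn ▸ dvd_pow_self 2 hn0.ne'
  -- Conjugation on F fixes 1, hence also a second point, by counting modulo 2.
  obtain ⟨⟨b, hbF⟩, hb, hb1⟩ := hp'.exists_fixed_point_of_prime_dvd_card_of_fixed_point
    (squareSubgroup G) hdvd (a := 1) fun g => smul_one g
  have hbc : ∀ g, Commute g b := by
    intro g
    have h1 := congrArg Subtype.val (hb (ConjAct.toConjAct g))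
    rw [ConjAct.Subgroup.val_conj_smul, ConjAct.toConjAct_smul] at h1
    exact mul_inv_eq_iff_eq_mul.1 h1
  obtain ⟨k, hk⟩ := IsPGroup.iff_orderOf.1 hp b
  cases k with
  | zero => exact absurd (Subtype.ext (orderOf_eq_one_iff.1 hk).symm) hb1
  | succ k =>
    refine ⟨b ^ 2 ^ k, pow_mem hbF _, fun h => ?_, ?_, fun g => (hbc g).pow_right _⟩
    · have := orderOf_le_of_pow_eq_one (by positivity) h
      rw [hk, pow_succ] at this
      have : 0 < 2 ^ k := by positivity
      omega
    · rw [← pow_add, ← mul_two, ← pow_succ, ← hk, pow_orderOf_eq_one]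

/-- Squares are central involutions. -/
theorem squareSubgroup_central (hG : MinimalThreeGenerated G) (hp : IsPGroup 2 G) :
    ∀ f ∈ squareSubgroup G, f * f = 1 ∧ ∀ g, g * f = f * g := by
  induction hn : Nat.card G using Nat.strong_induction_on generalizing G with
  | _ n ih =>
    by_cases hbot : squareSubgroup G = ⊥
    · intro f hf
      rw [hbot, mem_bot] at hf
      simp [hf]
    obtain ⟨z, hzF, hz1, hz2, hzc⟩ := exists_central_involution hp hbot
    have hmemz : ∀ {x}, x ∈ zpowers z → x = 1 ∨ x = z := by
      rintro _ ⟨k, rfl⟩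
      rcases Int.even_or_odd' k with ⟨m, rfl | rfl⟩
      · left
        exact (zpow_mul z 2 m).trans (by rw [zpow_two, hz2, one_zpow])
      · right
        exact (zpow_add z (2 * m) 1).trans
          (by rw [zpow_mul, zpow_two, hz2, one_zpow, one_mul, zpow_one])
    have hN : (zpowers z).Normal := by
      refine ⟨fun l hl g => ?_⟩
      rcases hmemz hl with rfl | rfl
      · simp
      · rwa [hzc, mul_inv_cancel_right]
    have hcard : Nat.card (G ⧸ zpowers z) < n := by
      rw [← hn, card_eq_card_quotient_mul_card_subgroup (zpowers z)]
      refine lt_mul_of_one_lt_right Nat.card_pos ?_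
      rw [one_lt_card_iff_ne_bot, Ne, zpowers_eq_bot]
      exact hz1
    have hker : (QuotientGroup.mk' (zpowers z)).ker ≤ squareSubgroup G := by
      rw [QuotientGroup.ker_mk', zpowers_le]
      exact hzF
    have hsurj := QuotientGroup.mk'_surjective (zpowers z)
    have hQ := ih _ hcard (hG.of_surjective _ hsurj hker) (hp.to_quotient _) rfl
    rw [← map_squareSubgroup _ hsurj] at hQ
    have hsq : ∀ f ∈ squareSubgroup G, f * f = 1 ∨ f * f = z := fun f hf =>
      hmemz ((QuotientGroup.eq_one_iff _).1 (hQ _ (mem_map_of_mem _ hf)).1)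
    have hconj : ∀ f ∈ squareSubgroup G, ∀ g, g * f = f * g ∨ g * f = f * z * g := by
      intro f hf g
      have h := (hQ _ (mem_map_of_mem _ hf)).2 g
      rcases hmemz (QuotientGroup.eq.1 h.symm) with h | h
      · left
        rw [inv_mul_eq_one] at h
        exact h.symm
      · right
        rw [inv_mul_eq_iff_eq_mul] at h
        exact h.trans (by rw [mul_assoc, mul_assoc, hzc])
    have hcen := hG.commute_of_conj_eq hzc hz2 hzF hconj hsq
    exact fun f hf => ⟨hG.mul_self_eq_one_of_central hz2 hsq hcen f hf, hcen f hf⟩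

theorem card_le (hG : MinimalThreeGenerated G) (hp : IsPGroup 2 G) : Nat.card G ≤ 2 ^ 5 := by
  have h1 : Nat.card (squareSubgroup G) ≤ 2 ^ Group.rank (squareSubgroup G) :=
    card_le_two_pow_rank fun f => Subtype.ext (hG.squareSubgroup_central hp f f.2).1
  have h2 := Nat.pow_le_pow_right (n := 2) (by norm_num)
    (hG.rank_le _ hG.squareSubgroup_ne_top)
  rw [← (squareSubgroup G).card_mul_index, hG.index_eq]
  omega

theorem upperCentralSeries_two (hG : MinimalThreeGenerated G) (hp : IsPGroup 2 G) :
    Subgroup.upperCentralSeries G 2 = ⊤ := by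
  have hle : squareSubgroup G ≤ Subgroup.upperCentralSeries G 1 := by
    rw [Subgroup.upperCentralSeries_one]
    exact fun f hf => mem_center_iff.2 (hG.squareSubgroup_central hp f hf).2
  refine eq_top_iff.2 fun x _ => Subgroup.mem_upperCentralSeries_succ_iff.2 fun y => hle ?_
  have h : ∀ q : G ⧸ squareSubgroup G, q * q = 1 := by
    intro q
    obtain ⟨g, rfl⟩ := QuotientGroup.mk_surjective q
    exact (QuotientGroup.eq_one_iff _).2 (mul_self_mem_squareSubgroup g)
  refine (QuotientGroup.eq_one_iff _).1 ?_
  have hc : (x : G ⧸ squareSubgroup G) * y = y * x :=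
    mul_comm_of_mul_self_eq_one (h _) (h _) (h _)
  exact commutatorElement_eq_one_iff_mul_comm.2 hc

end MinimalThreeGenerated

/-! ### From generator rank to the index of the squares -/

theorem squareSubgroup_le_frattini {G : Type*} [Group G] [Finite G] (hp : IsPGroup 2 G) :
    squareSubgroup G ≤ frattini G := by
  have : Fact (Nat.Prime 2) := ⟨Nat.prime_two⟩
  refine le_iInf₂ fun M hM => ?_
  obtain ⟨n, hn⟩ := IsPGroup.iff_card.1 (hp.to_subgroup M)
  obtain ⟨m, hm⟩ := hp.index M
  have hm0 : m ≠ 0 := by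
    rintro rfl
    exact hM.1 (index_eq_one.1 (by simpa using hm))
  have hdvd : 2 ^ (n + 1) ∣ Nat.card G := by
    rw [← M.card_mul_index, hn, hm, ← pow_add]
    exact pow_dvd_pow 2 (by omega)
  -- A subgroup twice as large as M must be G by maximality, so M has index 2.
  obtain ⟨K, hK, hMK⟩ := Sylow.exists_subgroup_card_pow_succ hdvd hn
  have hlt : M < K := by
    refine lt_of_le_of_ne hMK ?_
    rintro rfl
    rw [hn] at hK
    exact absurd (Nat.pow_right_injective le_rfl hK) (by omega)
  have hidx : M.index = 2 := by
    have h := M.card_mul_index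
    rw [← card_top (G := G), ← hM.2 K hlt, hK, hn, pow_succ] at h
    exact Nat.eq_of_mul_eq_mul_left (by positivity) h
  exact squareSubgroup_le fun g => mul_self_mem_of_index_two hidx g

theorem squareSubgroup_index_eq_eight {G : Type*} [Group G] [Finite G] (hp : IsPGroup 2 G)
    (hd : Group.rank G = 3) : (squareSubgroup G).index = 8 := by
  classical
  have hsurj := QuotientGroup.mk'_surjective (squareSubgroup G)
  have hle : (squareSubgroup G).index ≤ 8 := by
    have h : ∀ q : G ⧸ squareSubgroup G, q * q = 1 := by
      intro q
      obtain ⟨g, rfl⟩ := QuotientGroup.mk_surjective q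
      exact (QuotientGroup.eq_one_iff _).2 (mul_self_mem_squareSubgroup g)
    have h1 := card_le_two_pow_rank h
    have h2 := Nat.pow_le_pow_right (n := 2) (by norm_num)
      (Group.rank_le_of_surjective _ hsurj)
    rw [hd] at h2
    exact h1.trans h2
  refine le_antisymm hle ?_
  -- Generators of G/F lift to generators of G, as F consists of nongenerators; two cannot suffice.
  have hgen : ∀ S : Finset G, S.card ≤ 2 →
      closure ((QuotientGroup.mk' (squareSubgroup G)) '' (S : Set G)) ≠ ⊤ := by
    intro S hS htop
    rw [← MonoidHom.map_closure] at htop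
    have h1 : closure (S : Set G) ⊔ squareSubgroup G = ⊤ := by
      rw [← QuotientGroup.ker_mk' (squareSubgroup G), ← comap_map_eq, htop, comap_top]
    have h2 : closure (S : Set G) = ⊤ := frattini_nongenerating
      (top_le_iff.1 (h1 ▸ sup_le_sup_left (squareSubgroup_le_frattini hp) _))
    have := Group.rank_le h2
    omega
  have hex : ∀ S : Finset G, S.card ≤ 2 → ∃ g : G, (QuotientGroup.mk' (squareSubgroup G)) g ∉
      closure ((QuotientGroup.mk' (squareSubgroup G)) '' (S : Set G)) := by
    intro S hS
    by_contra! h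
    refine hgen S hS (eq_top_iff.2 fun q _ => ?_)
    obtain ⟨g, rfl⟩ := hsurj q
    exact h g
  obtain ⟨a, ha⟩ := hex ∅ (by simp)
  obtain ⟨b, hb⟩ := hex {a} (by simp)
  obtain ⟨c, hc⟩ := hex {b, a} Finset.card_le_two
  rw [Finset.coe_empty, Set.image_empty, Subgroup.closure_empty, mem_bot] at ha
  rw [Finset.coe_singleton, Set.image_singleton] at hb
  rw [Finset.coe_insert, Finset.coe_singleton, Set.image_insert_eq, Set.image_singleton] at hc
  exact (eight_le_card_closure ha hb hc).trans (card_le_card_group _)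

theorem mainTheorem7 (G : Type*) [Group G] [Finite G] (hG : IsPGroup 2 G)
    (hmax : IsDMaximal G) (hd : Group.rank G = 3) :
    (Group.IsNilpotent G ∧ Group.nilpotencyClass G ≤ 2) ∧ Nat.card G ≤ 2 ^ 5 := by
  have hM : MinimalThreeGenerated G :=
    ⟨fun H hH => Nat.le_of_lt_succ ((hmax H hH.lt_top).trans_eq hd), squareSubgroup_index_eq_eight hG hd⟩
  have h2 := hM.upperCentralSeries_two hG
  have hnil : Group.IsNilpotent G := ⟨2, h2⟩
  exact ⟨⟨hnil, Subgroup.upperCentralSeries_eq_top_iff_nilpotencyClass_le.1 h2⟩, hM.card_le hG⟩
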